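/- **Definitions.** All graphs are finite and simple. A graph is \emph{strongly regular} if it is regular, the number of common neighbours of two adjacent vertices is a constant $\lambda$, and the number of common neighbours of two distinct non-adjacent vertices is a constant $\mu$. A strongly regular graph with more than one vertex is \emph{primitive} if it and its complement are connected. The \emph{local graph} of $\Gamma$ at a vertex is the subgraph induced on its neighbours. For an integer $m\ge 1$, the \emph{$m$-clique extension} of a graph $\Delta$ with vertex set $W$ has vertex set $\{1,\dots,m\}\times W$, where $(i,\alpha)$ and $(j,\beta)$ are adjacent if and only if $\alpha,\beta$ are adjacent in $\Delta$, or $\alpha=\beta$ and $i\ne j$. For a graph $\Gamma$ with vertex set $\Omega$, let $A_0=I$, let $A_1$ and $A_2$ be the adjacency matrices of $\Gamma$ and of its complement, and for $\omega\in\Omega$ let $E^*_{0,\omega},E^*_{1,\omega},E^*_{2,\omega}$ be the diagonal $0/1$ matrices whose diagonals are the characteristic vectors of $\{\omega\}$, of the set of neighbours of $\omega$, and of the set of the other vertices. In the algebra of complex matrices indexed by $\Omega$, let $T_{0,\omega}$ be the linear span of the matrices $E^*_{i,\omega}A_jE^*_{k,\omega}$ ($0\le i,j,k\le 2$), let $T_\omega$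 be the subalgebra generated by all $A_j$ and $E^*_{i,\omega}$ (the Terwilliger algebra), and let $\tilde T_\omega$ be the algebra of all matrices that commute with the permutation matrices of the automorphisms of $\Gamma$ fixing $\omega$. The graph $\Gamma$ is \emph{triply transitive} if $\operatorname{Aut}(\Gamma)$ is transitive on $\Omega$ and $T_{0,\omega}=T_\omega=\tilde T_\omega$ for every $\omega\in\Omega$. A \emph{finite classical polar space} over $\mathbb F_q$ is the geometry of totally isotropic (respectively totally singular) subspaces of a finite-dimensional vector space over $\mathbb F_q$ with a nondegenerate alternating form, a nondegenerate Hermitian form (with respect to a field automorphism of order two), or a nonsingular quadratic form. Its \emph{rank} is the largest vector space dimension of such a subspace, its \emph{points} are the one-dimensional such subspaces, and in its \emph{collinearity graph} two distinct points are adjacent if and only if the two-dimensional subspace they span is totally isotropic (respectively totally singular). **Theorem.** Let $\mathcal P$ be a finite classical polar space of rank $n\ge 3$ over $\mathbb F_q$, with collinearity graph $\Gamma$. Then $\Gamma$ is a primitive strongly regular graph, and $\Gamma$ is not triply transitive. Moreover: 1. the local graph of $\Gamma$ at every point is isomorphic to the $q$-clique extension of the collinearity graph of some classical polar space of rank $n-1$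 over $\mathbb F_q$, and the latter graph is a primitive strongly regular graph; 2. no local graph of $\Gamma$ is strongly regular; 3. for every primitive strongly regular graph $\Delta$ and every integer $m\ge 2$, the $m$-clique extension of $\Delta$ is not strongly regular. -/

import Mathlib

universe u v w

section GraphNotions

variable {V : Type*}

open Classical in
/-- A finite graph is strongly regular if it is so for some parameters. Complete graphs and
edgeless graphs are allowed. -/
def IsStronglyRegular [Finite V] (G : SimpleGraph V) : Prop :=
  letI : Fintype V := Fintype.ofFinite V
  ∃ n k l m : ℕ, G.IsSRGWith n k l m

/-- A primitive strongly regular graph: it and its complement are connected (and it has more than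
one vertex; the one-vertex graph is not a two-class association scheme). -/
def IsPrimitiveSRG [Finite V] (G : SimpleGraph V) : Prop :=
  IsStronglyRegular G ∧ Nontrivial V ∧ G.Connected ∧ Gᶜ.Connected

/-- The `m`-clique extension of a graph: every vertex is replaced by a clique of size `m`. -/
def cliqueExtension (m : ℕ) (G : SimpleGraph V) : SimpleGraph (Fin m × V) where
  Adj a b := G.Adj a.2 b.2 ∨ (a.2 = b.2 ∧ a.1 ≠ b.1)
  symm := ⟨fun _ _ h => h.elim (fun h => Or.inl h.symm) (fun h => Or.inr ⟨h.1.symm, h.2.symm⟩)⟩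
  loopless := ⟨fun a h => h.elim (fun h => G.loopless.irrefl a.2 h) (fun h => h.2 rfl)⟩

/-- The subgraph induced on the neighbours of `x` (the first subconstituent at `x`). -/
abbrev localGraph (G : SimpleGraph V) (x : V) : SimpleGraph (G.neighborSet x) :=
  G.induce (G.neighborSet x)

/-- The relations `R₀`, `R₁`, `R₂` of the scheme of a graph: equality, adjacency, and
non-adjacency of distinct vertices. -/
def schemeRel (G : SimpleGraph V) : Fin 3 → V → V → Prop :=
  ![fun x y => x = y, G.Adj, Gᶜ.Adj]

open Classical in
/-- The adjacency matrix `A_j` of the relation `R_j`. -/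
noncomputable def schemeMatrix (G : SimpleGraph V) (j : Fin 3) : Matrix V V ℂ :=
  Matrix.of fun x y => if schemeRel G j x y then 1 else 0

open Classical in
/-- The diagonal idempotent `E*_{i,ω}`. -/
noncomputable def dualIdempotent (G : SimpleGraph V) (ω : V) (i : Fin 3) : Matrix V V ℂ :=
  Matrix.diagonal fun x => if schemeRel G i ω x then 1 else 0

/-- The space `T_{0,ω}` spanned by the products `E*_i A_j E*_k`. -/
noncomputable def tripleSpan [Fintype V] (G : SimpleGraph V) (ω : V) :
    Submodule ℂ (Matrix V V ℂ) :=
  Submodule.span ℂ {M | ∃ i j k : Fin 3,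
    M = dualIdempotent G ω i * schemeMatrix G j * dualIdempotent G ω k}

open Classical in
/-- The Terwilliger algebra `T_ω`, generated by all `A_j` and all `E*_{i,ω}`. -/
noncomputable def terwilligerAlgebra [Fintype V] (G : SimpleGraph V) (ω : V) :
    Subalgebra ℂ (Matrix V V ℂ) :=
  Algebra.adjoin ℂ (Set.range (schemeMatrix G) ∪ Set.range (dualIdempotent G ω))

open Classical in
/-- The centralizer algebra of the stabilizer of `ω` in the automorphism group: all matrices that
commute with the permutation matrices of the automorphisms fixing `ω`. -/
noncomputable def stabilizerCentralizer [Fintype V] (G : SimpleGraph V) (ω : V) :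
    Subalgebra ℂ (Matrix V V ℂ) :=
  Subalgebra.centralizer ℂ
    {P | ∃ g : G ≃g G, g ω = ω ∧ P = Equiv.Perm.permMatrix ℂ g.toEquiv}

open Classical in
/-- Triple transitivity: the automorphism group is transitive on the vertices, and the three spaces
`T_{0,ω}`, `T_ω` and the centralizer algebra of the stabilizer of `ω` coincide. -/
def IsTriplyTransitive [Finite V] (G : SimpleGraph V) : Prop :=
  letI : Fintype V := Fintype.ofFinite V
  (∀ x y : V, ∃ g : G ≃g G, g x = y) ∧
    ∀ ω : V, tripleSpan G ω = Subalgebra.toSubmodule (terwilligerAlgebra G ω) ∧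
      terwilligerAlgebra G ω = stabilizerCentralizer G ω

end GraphNotions

/-- A classical polar space on the vector space `V` over `K`, given by the form that defines it: a
nondegenerate alternating form, a nondegenerate Hermitian form for a field automorphism of order
two, or a nonsingular quadratic form (no nonzero singular vector lies in the radical of the
polar form; in characteristic two the polar form itself may be degenerate). -/
inductive ClassicalPolarSpace (K V : Type*) [Field K] [AddCommGroup V] [Module K V] where
  | symplectic (B : V →ₗ[K] V →ₗ[K] K) (alt : B.IsAlt) (nondeg : B.Nondegenerate)
  | hermitian (σ : K →+* K) (order_two : (∀ a, σ (σ a) = a) ∧ ∃ a, σ a ≠ a)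
      (B : V →ₛₗ[σ] V →ₗ[K] K) (symm : B.IsSymm) (nondeg : B.Nondegenerate)
  | orthogonal (Q : QuadraticForm K V)
      (nonsing : ∀ x, Q x = 0 → (∀ y, QuadraticMap.polar Q x y = 0) → x = 0)

namespace ClassicalPolarSpace

variable {K V : Type*} [Field K] [AddCommGroup V] [Module K V]

/-- Totally isotropic subspaces (totally singular ones in the orthogonal case): the subspaces that
belong to the polar space. -/
def IsSingular : ClassicalPolarSpace K V → Submodule K V → Prop
  | symplectic B _ _, W => ∀ x ∈ W, ∀ y ∈ W, B x y = 0
  | hermitian _ _ B _ _, W => ∀ x ∈ W, ∀ y ∈ W, B x y = 0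
  | orthogonal Q _, W => ∀ x ∈ W, Q x = 0

/-- The rank: the largest vector space dimension of a totally singular subspace. -/
def HasRank (P : ClassicalPolarSpace K V) (n : ℕ) : Prop :=
  IsGreatest {d | ∃ W : Submodule K V, P.IsSingular W ∧ Module.finrank K W = d} n

/-- The points of the polar space: the one-dimensional totally singular subspaces. -/
abbrev Point (P : ClassicalPolarSpace K V) : Type _ :=
  {p : Projectivization K V // P.IsSingular p.submodule}

instance finite_point [Finite K] [FiniteDimensional K V] (P : ClassicalPolarSpace K V) :
    Finite P.Point :=
  haveI : Finite V := Module.finite_of_finite K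
  inferInstance

/-- Two distinct points are adjacent if the line joining them is totally singular. -/
def collinearityGraph (P : ClassicalPolarSpace K V) : SimpleGraph P.Point where
  Adj p r := p ≠ r ∧ P.IsSingular (p.1.submodule ⊔ r.1.submodule)
  symm := ⟨fun _ _ h => ⟨h.1.symm, by rw [sup_comm]; exact h.2⟩⟩
  loopless := ⟨fun _ h => h.1 rfl⟩

end ClassicalPolarSpace

/-! If `T_0 = T` at a vertex `ω`, then `M = E*_1 A_1 E*_1`, the adjacency matrix of the local graph
padded with zeros, has its square in `T_0`. Entries of members of `T_0` depend only on the relations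
among `ω`, row and column, while entries of `M * M` count common neighbours in the local graph. So
the local graph is strongly regular (`isStronglyRegular_localGraph`), and it is enough to refute
this for polar spaces.

For singular `x`, `y` with `form x y = 1`, the form restricts to a polar space of rank `n - 1` on
the subspace orthogonal to both, the residue. Each point collinear with `⟨x⟩` is `⟨u + a x⟩` for a
unique scalar `a` and a unique residue point, `u` being its fixed representative; collinearity
ignores `a`. Hence the local graph is a `q`-clique extension (`localIso`). In a strongly regular
proper clique extension, comparing twin vertices with other adjacent ones makes adjacency in the
base transitive; a connected base is then complete, so not primitive.

Strong regularity of the polar graphs is obtained by counting, with perpendicular spaces compared by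
cardinality instead of by Witt's theorem. The three kinds of form are handled together through
`form`, `quad` and `tr`, related by `quad_add`. -/

section StronglyRegular

/-! ### Strong regularity and isomorphism invariance. -/

variable {V W : Type*}

/-- Strong regularity without explicit parameters: the number of common neighbours of two vertices
depends only on whether they are equal, adjacent, or distinct and non-adjacent. -/
theorem isStronglyRegular_iff [Finite V] {G : SimpleGraph V} :
    IsStronglyRegular G ↔
      (∀ x y, (G.neighborSet x).ncard = (G.neighborSet y).ncard) ∧
      (∀ x y x' y', G.Adj x y → G.Adj x' y' →
        (G.commonNeighbors x y).ncard = (G.commonNeighbors x' y').ncard) ∧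
      (∀ x y x' y', Gᶜ.Adj x y → Gᶜ.Adj x' y' →
        (G.commonNeighbors x y).ncard = (G.commonNeighbors x' y').ncard) := by
  classical
  let _ : Fintype V := Fintype.ofFinite V
  have hdeg (x : V) : (G.neighborSet x).ncard = G.degree x := by
    rw [← Nat.card_coe_set_eq, Nat.card_eq_fintype_card, SimpleGraph.card_neighborSet_eq_degree]
  have hcom (x y : V) : (G.commonNeighbors x y).ncard = Fintype.card (G.commonNeighbors x y) := by
    rw [← Nat.card_coe_set_eq, Nat.card_eq_fintype_card]
  constructor
  · rintro ⟨n, k, l, m, h⟩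
    refine ⟨fun x y => ?_, fun x y x' y' hxy hxy' => ?_, fun x y x' y' hxy hxy' => ?_⟩
    · have hx := h.regular x
      have hy := h.regular y
      rw [hdeg, hdeg]
      convert hx.trans hy.symm
    · have h1 := h.of_adj x y hxy
      have h2 := h.of_adj x' y' hxy'
      rw [hcom, hcom]
      convert h1.trans h2.symm
    · have h1 := h.of_not_adj hxy.1 hxy.2
      have h2 := h.of_not_adj hxy'.1 hxy'.2
      rw [hcom, hcom]
      convert h1.trans h2.symm
  · rintro ⟨h0, h1, h2⟩
    -- A parameter governed by no vertex or pair is arbitrary; it is set to 0.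
    have e0 : ∃ k, ∀ x, (G.neighborSet x).ncard = k := by
      rcases isEmpty_or_nonempty V with _ | ⟨⟨x⟩⟩
      · exact ⟨0, fun x => isEmptyElim x⟩
      · exact ⟨_, fun y => h0 y x⟩
    have e1 : ∃ l, ∀ x y, G.Adj x y → (G.commonNeighbors x y).ncard = l := by
      by_cases h : ∃ x y, G.Adj x y
      · obtain ⟨x, y, h⟩ := h
        exact ⟨_, fun x' y' h' => h1 x' y' x y h' h⟩
      · exact ⟨0, fun x y hxy => (h ⟨x, y, hxy⟩).elim⟩
    have e2 : ∃ m, ∀ x y, Gᶜ.Adj x y → (G.commonNeighbors x y).ncard = m := by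
      by_cases h : ∃ x y, Gᶜ.Adj x y
      · obtain ⟨x, y, h⟩ := h
        exact ⟨_, fun x' y' h' => h2 x' y' x y h' h⟩
      · exact ⟨0, fun x y hxy => (h ⟨x, y, hxy⟩).elim⟩
    obtain ⟨k, hk⟩ := e0
    obtain ⟨l, hl⟩ := e1
    obtain ⟨m, hm⟩ := e2
    refine ⟨_, k, l, m, rfl, fun x => ?_, fun x y hxy => ?_, fun x y hne hxy => ?_⟩
    · rw [← hk x, hdeg]
    · rw [← hl x y hxy, hcom]
    · rw [← hm x y ⟨hne, hxy⟩, hcom]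

theorem ncard_neighborSet_iso {G : SimpleGraph V} {H : SimpleGraph W} (e : G ≃g H) (x : V) :
    (H.neighborSet (e x)).ncard = (G.neighborSet x).ncard := by
  rw [← Set.ncard_image_of_injective _ e.injective]
  congr 1
  ext y
  obtain ⟨y, rfl⟩ := e.surjective y
  simp [SimpleGraph.Iso.map_adj_iff]

theorem ncard_commonNeighbors_iso {G : SimpleGraph V} {H : SimpleGraph W} (e : G ≃g H) (x y : V) :
    (H.commonNeighbors (e x) (e y)).ncard = (G.commonNeighbors x y).ncard := by
  rw [← Set.ncard_image_of_injective _ e.injective]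
  congr 1
  ext z
  obtain ⟨z, rfl⟩ := e.surjective z
  simp [SimpleGraph.mem_commonNeighbors, SimpleGraph.Iso.map_adj_iff]

theorem IsStronglyRegular.of_iso [Finite V] [Finite W] {G : SimpleGraph V} {H : SimpleGraph W}
    (e : G ≃g H) (h : IsStronglyRegular G) : IsStronglyRegular H := by
  rw [isStronglyRegular_iff] at h ⊢
  obtain ⟨h0, h1, h2⟩ := h
  refine ⟨fun x y => ?_, fun x y x' y' hxy hxy' => ?_, fun x y x' y' hxy hxy' => ?_⟩
  · obtain ⟨x, rfl⟩ := e.surjective x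
    obtain ⟨y, rfl⟩ := e.surjective y
    rw [ncard_neighborSet_iso, ncard_neighborSet_iso]
    exact h0 _ _
  all_goals
    obtain ⟨x, rfl⟩ := e.surjective x
    obtain ⟨y, rfl⟩ := e.surjective y
    obtain ⟨x', rfl⟩ := e.surjective x'
    obtain ⟨y', rfl⟩ := e.surjective y'
    rw [ncard_commonNeighbors_iso, ncard_commonNeighbors_iso]
  · exact h1 _ _ _ _ (e.map_adj_iff.1 hxy) (e.map_adj_iff.1 hxy')
  · simp only [SimpleGraph.compl_adj, e.map_adj_iff, ne_eq, e.injective.eq_iff] at hxy hxy'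
    exact h2 _ _ _ _ hxy hxy'

theorem ncard_neighborSet_add_ncard_compl [Finite V] (G : SimpleGraph V) (x : V) :
    (G.neighborSet x).ncard + (Gᶜ.neighborSet x).ncard + 1 = Nat.card V := by
  have h : (Gᶜ.neighborSet x) ∪ {x} = (G.neighborSet x)ᶜ := by
    ext y
    by_cases hy : y = x
    · subst hy; simp
    · simp [hy, Ne.symm hy]
  rw [← Set.ncard_add_ncard_compl (G.neighborSet x), ← h,
    Set.ncard_union_eq (by simp), Set.ncard_singleton, add_assoc]

theorem ncard_neighborSet_localGraph (G : SimpleGraph V) (x : V) (y : G.neighborSet x) :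
    ((localGraph G x).neighborSet y).ncard = (G.commonNeighbors x y).ncard := by
  rw [← Set.ncard_image_of_injective _ Subtype.val_injective]
  congr 1
  ext z
  simp [SimpleGraph.mem_commonNeighbors, and_comm]

/-! ### Clique extensions. -/

theorem ncard_compl_neighborSet_cliqueExtension (m : ℕ) (G : SimpleGraph V) (a : Fin m × V) :
    ((cliqueExtension m G)ᶜ.neighborSet a).ncard = m * (Gᶜ.neighborSet a.2).ncard := by
  have h : (cliqueExtension m G)ᶜ.neighborSet a = Set.univ ×ˢ Gᶜ.neighborSet a.2 := by
    ext ⟨i, y⟩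
    obtain ⟨j, x⟩ := a
    have : G.Adj x y → x ≠ y := fun h => h.ne
    simp only [cliqueExtension, SimpleGraph.mem_neighborSet, SimpleGraph.compl_adj, ne_eq,
      Prod.mk.injEq, not_or, not_and, not_not, Set.mem_prod, Set.mem_univ, true_and]
    tauto
  rw [h, Set.ncard_prod, Set.ncard_univ, Nat.card_fin]

/-- If a proper clique extension is strongly regular, adjacency in the base graph is transitive on
distinct vertices: compare the common neighbours of two copies of `a` with those of `a` and `b`. -/
theorem adj_of_isStronglyRegular_cliqueExtension [Finite V] {G : SimpleGraph V} {m : ℕ}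
    (hm : 2 ≤ m) (h : IsStronglyRegular (cliqueExtension m G)) {a b c : V} (hab : G.Adj a b)
    (hac : G.Adj a c) (hbc : b ≠ c) : G.Adj b c := by
  by_contra hnot
  let i : Fin m := ⟨0, by omega⟩
  let j : Fin m := ⟨1, by omega⟩
  have hij : i ≠ j := by simp [i, j]
  set E := cliqueExtension m G with hE
  have adjE : ∀ k l x y, E.Adj (k, x) (l, y) ↔ G.Adj x y ∨ (x = y ∧ k ≠ l) := fun _ _ _ _ => Iff.rfl
  have key := (isStronglyRegular_iff.1 h).2.1 (i, a) (j, a) (i, a) (i, b)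
    ((adjE _ _ _ _).2 (Or.inr ⟨rfl, hij⟩)) ((adjE _ _ _ _).2 (Or.inl hab))
  set S := E.commonNeighbors (i, a) (j, a)
  set R := E.commonNeighbors (i, a) (i, b)
  -- Passing from `S` to `R` gains at most `(j, a)` but loses both `(i, b)` and, since `b` and `c`
  -- are not adjacent, `(i, c)`; so `R` is strictly smaller than `S`.
  have hsub : R ⊆ insert (j, a) (S \ {(i, b), (i, c)}) := by
    rintro ⟨k, z⟩ hz
    simp only [R, S, SimpleGraph.mem_commonNeighbors, adjE, Set.mem_insert_iff, Set.mem_sdiff,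
      Set.mem_singleton_iff, Prod.mk.injEq] at hz ⊢
    have := hab.ne
    have := G.loopless.irrefl b
    grind
  have hpair : ({(i, b), (i, c)} : Set (Fin m × V)) ⊆ S := by
    rintro z (rfl | rfl) <;>
      simp [S, SimpleGraph.mem_commonNeighbors, adjE, hab, hac]
  have h1 := Set.ncard_le_ncard hsub
  have h2 := Set.ncard_insert_le (j, a) (S \ {(i, b), (i, c)})
  have h3 := Set.ncard_sdiff_add_ncard_of_subset hpair
  rw [Set.ncard_pair (by simp [hbc])] at h3
  omega

/-- Transitivity of adjacency collapses every walk to an edge or a point, so a connected base is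
complete and its complement has no edge. -/
theorem not_isStronglyRegular_cliqueExtension [Finite V] {G : SimpleGraph V}
    (hG : IsPrimitiveSRG G) {m : ℕ} (hm : 2 ≤ m) :
    ¬ IsStronglyRegular (cliqueExtension m G) := by
  intro h
  obtain ⟨-, hnt, hconn, hcompl⟩ := hG
  have hall : ∀ x y, G.Reachable x y → x = y ∨ G.Adj x y := by
    intro x y hxy
    obtain ⟨p⟩ := hxy
    induction p with
    | nil => exact Or.inl rfl
    | @cons x y z hxy p ih =>
      rcases ih with rfl | hyz
      · exact Or.inr hxy
      · by_cases hxz : x = z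
        · exact Or.inl hxz
        · exact Or.inr (adj_of_isStronglyRegular_cliqueExtension hm h hxy.symm hyz hxz)
  obtain ⟨x⟩ := hcompl.nonempty
  obtain ⟨y, hxy⟩ := hcompl.preconnected.exists_adj_of_nontrivial x
  rcases hall x y (hconn.preconnected x y) with rfl | hadj
  · exact hxy.1 rfl
  · exact hxy.2 hadj

/-! ### Triple products and the local graph. -/

theorem tripleSpan_apply_eq [Fintype V] {G : SimpleGraph V} {ω : V} {M : Matrix V V ℂ}
    (hM : M ∈ tripleSpan G ω) {x y x' y' : V}
    (hx : ∀ i, schemeRel G i ω x ↔ schemeRel G i ω x')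
    (hxy : ∀ i, schemeRel G i x y ↔ schemeRel G i x' y')
    (hy : ∀ i, schemeRel G i ω y ↔ schemeRel G i ω y') : M x y = M x' y' := by
  classical
  unfold tripleSpan at hM
  induction hM using Submodule.span_induction with
  | mem M h =>
    obtain ⟨i, j, k, rfl⟩ := h
    simp only [dualIdempotent, schemeMatrix, Matrix.mul_diagonal, Matrix.diagonal_mul,
      Matrix.of_apply, hx, hxy, hy]
  | zero => rfl
  | add M N _ _ hM hN => simp [hM, hN]
  | smul a M _ hM => simp [hM]

open Classical in
/-- If the Terwilliger algebra is spanned by the triple products, the local graph is strongly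
regular. -/
theorem isStronglyRegular_localGraph [Fintype V] {G : SimpleGraph V} {ω : V}
    (h : tripleSpan G ω = Subalgebra.toSubmodule (terwilligerAlgebra G ω)) :
    IsStronglyRegular (localGraph G ω) := by
  let M := dualIdempotent G ω 1 * schemeMatrix G 1 * dualIdempotent G ω 1
  have hM : M ∈ tripleSpan G ω := Submodule.subset_span ⟨1, 1, 1, rfl⟩
  have hMM : M * M ∈ tripleSpan G ω := by
    rw [h] at hM ⊢
    exact (terwilligerAlgebra G ω).mul_mem hM hM
  have hMapp (x y : V) : M x y = if G.Adj ω x ∧ G.Adj x y ∧ G.Adj ω y then 1 else 0 := by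
    simp only [M, dualIdempotent, schemeMatrix, Matrix.mul_diagonal, Matrix.diagonal_mul,
      Matrix.of_apply, schemeRel, Matrix.cons_val_one, Matrix.cons_val_zero]
    by_cases h1 : G.Adj ω x <;> by_cases h2 : G.Adj x y <;> by_cases h3 : G.Adj ω y <;>
      simp [h1, h2, h3]
  have hentry (x y : G.neighborSet ω) :
      (M * M) x y = (((localGraph G ω).commonNeighbors x y).ncard : ℂ) := by
    have hx : G.Adj ω x := x.2
    have hy : G.Adj ω y := y.2
    have hmem (z : V) : z ∈ Set.image Subtype.val ((localGraph G ω).commonNeighbors x y) ↔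
        G.Adj ω z ∧ G.Adj x z ∧ G.Adj y z := by
      simp [SimpleGraph.mem_commonNeighbors, and_comm (b := G.Adj ω z)]
    rw [← Set.ncard_image_of_injective _ Subtype.val_injective, Set.ncard_eq_toFinset_card',
      Matrix.mul_apply, Finset.card_eq_sum_ones, Nat.cast_sum, Nat.cast_one,
      ← Finset.sum_subset (Finset.subset_univ _)]
    · refine Finset.sum_congr rfl fun z hz => ?_
      obtain ⟨hz, hxz, hyz⟩ := (hmem z).1 (Set.mem_toFinset.1 hz)
      simp [hMapp, hx, hy, hz, hxz, hyz.symm]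
    · intro z _ hz
      rw [Set.mem_toFinset, hmem] at hz
      simp only [hMapp, hx, hy, G.adj_comm z y, true_and, and_true]
      by_cases h1 : G.Adj ω z <;> by_cases h2 : G.Adj x z <;> by_cases h3 : G.Adj y z <;> simp_all
  have hrel (x x' : G.neighborSet ω) (i : Fin 3) : schemeRel G i ω x ↔ schemeRel G i ω x' := by
    have hx := x.2
    have hx' := x'.2
    simp only [SimpleGraph.mem_neighborSet] at hx hx'
    fin_cases i <;> simp [schemeRel, hx, hx', hx.ne, hx'.ne]
  have heq (x y x' y' : G.neighborSet ω)
      (hxy : ∀ i, schemeRel G i (x : V) y ↔ schemeRel G i (x' : V) y') :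
      ((localGraph G ω).commonNeighbors x y).ncard =
        ((localGraph G ω).commonNeighbors x' y').ncard := by
    have := tripleSpan_apply_eq hMM (hrel x x') hxy (hrel y y')
    rw [hentry, hentry] at this
    exact_mod_cast this
  refine isStronglyRegular_iff.2 ⟨fun x y => ?_, fun x y x' y' hxy hxy' => ?_,
    fun x y x' y' hxy hxy' => ?_⟩
  -- Diagonal entries of `M * M` give the valency.
  · have := heq x x y y (by intro i; fin_cases i <;> simp [schemeRel])
    simpa [SimpleGraph.commonNeighbors] using this
  · refine heq x y x' y' fun i => ?_
    simp only [SimpleGraph.comap_adj, Function.Embedding.subtype_apply] at hxy hxy'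
    fin_cases i <;> simp [schemeRel, hxy, hxy', hxy.ne, hxy'.ne]
  · refine heq x y x' y' fun i => ?_
    simp only [SimpleGraph.compl_adj, SimpleGraph.comap_adj, Function.Embedding.subtype_apply,
      ne_eq, Subtype.ext_iff] at hxy hxy'
    fin_cases i <;> simp [schemeRel, hxy, hxy']

end StronglyRegular

namespace ClassicalPolarSpace

/-! ### Uniform treatment of the three kinds of form. -/

section Forms

variable {K V : Type*} [Field K] [AddCommGroup V] [Module K V]

/-- The field automorphism with respect to which the form is sesquilinear. -/
def conj : ClassicalPolarSpace K V → K →+* K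
  | symplectic _ _ _ => RingHom.id K
  | hermitian σ _ _ _ _ => σ
  | orthogonal _ _ => RingHom.id K

/-- The reflexive sesquilinear form of a polar space (the polar form in the orthogonal case). -/
def form : ClassicalPolarSpace K V → V → V →ₗ[K] K
  | symplectic B _ _ => fun x => B x
  | hermitian _ _ B _ _ => fun x => B x
  | orthogonal Q _ => fun x => Q.polarBilin x

/-- The function whose zeros are the singular vectors. -/
def quad : ClassicalPolarSpace K V → V → K
  | symplectic _ _ _ => fun _ => 0
  | hermitian _ _ B _ _ => fun x => B x x
  | orthogonal Q _ => Q

/-- The additive map that expresses the polarization of `quad` through `form`. -/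
def tr : ClassicalPolarSpace K V → K →+ K
  | symplectic _ _ _ => 0
  | hermitian σ _ _ _ _ => AddMonoidHom.id K + σ.toAddMonoidHom
  | orthogonal _ _ => AddMonoidHom.id K

variable (P : ClassicalPolarSpace K V)

theorem form_add_left (x y z : V) : P.form (x + y) z = P.form x z + P.form y z := by
  cases P <;> simp [form]

theorem form_smul_left (a : K) (x z : V) : P.form (a • x) z = P.conj a * P.form x z := by
  cases P <;> simp [form, conj]

variable {P} in
theorem form_eq_zero_symm {x y : V} (h : P.form x y = 0) : P.form y x = 0 := by
  cases P with
  | symplectic B alt _ => exact alt.isRefl x y h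
  | hermitian σ _ B symm _ => exact symm.isRefl x y h
  | orthogonal Q _ =>
    simp only [form, QuadraticMap.polarBilin_apply_apply] at h ⊢
    rwa [QuadraticMap.polar_comm]

theorem quad_add (x y : V) : P.quad (x + y) = P.quad x + P.quad y + P.tr (P.form x y) := by
  cases P with
  | symplectic B alt _ => simp [quad, tr]
  | hermitian σ _ B symm _ =>
    simp only [quad, tr, form, map_add, LinearMap.add_apply, AddMonoidHom.add_apply,
      AddMonoidHom.id_apply, RingHom.toAddMonoidHom_eq_coe, AddMonoidHom.coe_coe, symm.eq]
    ring
  | orthogonal Q _ => simp [quad, tr, form, QuadraticMap.polar]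

variable {P} in
theorem quad_smul {x : V} (hx : P.quad x = 0) (a : K) : P.quad (a • x) = 0 := by
  cases P with
  | symplectic B alt _ => rfl
  | hermitian σ _ B symm _ => simp_all [quad]
  | orthogonal Q _ => simp_all [quad, QuadraticMap.map_smul]

variable {P} in
theorem form_self {x : V} (hx : P.quad x = 0) : P.form x x = 0 := by
  cases P with
  | symplectic B alt _ => exact alt x
  | hermitian σ _ B symm _ => exact hx
  | orthogonal Q _ => simp_all [quad, form]

theorem exists_tr_eq (x : V) : ∃ a, P.tr a = - P.quad x := by
  cases P with
  | symplectic B alt _ => exact ⟨0, by simp [tr, quad]⟩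
  | hermitian σ hσ B symm _ =>
    obtain ⟨hinv, c, hc⟩ := hσ
    -- If the trace vanished identically, its value at 1 would give characteristic two, and its
    -- value at `c` would then give `σ c = c`. As `B x x` is fixed by `σ`, a fixed multiple of `b`
    -- attains the required trace.
    obtain ⟨b, hb⟩ : ∃ b, b + σ b ≠ 0 := by
      by_contra! hall
      have h1 := hall 1
      have h2 := hall c
      rw [map_one] at h1
      refine hc (eq_of_sub_eq_zero ?_)
      linear_combination h2 - c * h1
    refine ⟨- (B x x) * (b + σ b)⁻¹ * b, ?_⟩
    have hfix : σ (b + σ b) = b + σ b := by rw [map_add, hinv, add_comm]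
    simp only [tr, quad, AddMonoidHom.add_apply, AddMonoidHom.id_apply,
      RingHom.toAddMonoidHom_eq_coe, AddMonoidHom.coe_coe, map_mul, map_neg, symm.eq, map_inv₀,
      hfix]
    field_simp
    ring
  | orthogonal Q _ => exact ⟨_, rfl⟩

variable {P} in
theorem eq_zero_of_form {x : V} (hx : P.quad x = 0) (h : ∀ y, P.form x y = 0) : x = 0 := by
  cases P with
  | symplectic B alt nondeg => exact nondeg.1 x h
  | hermitian σ _ B symm nondeg => exact nondeg.1 x h
  | orthogonal Q nonsing => exact nonsing x hx fun y => h y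

/-- In the orthogonal case polarization makes the bilinear condition automatic; in the Hermitian
case `quad` is the diagonal of `form`. -/
theorem isSingular_iff (W : Submodule K V) :
    P.IsSingular W ↔ ∀ x ∈ W, P.quad x = 0 ∧ ∀ y ∈ W, P.form x y = 0 := by
  cases P with
  | symplectic B alt nondeg => simp [IsSingular, quad, form]
  | hermitian σ _ B symm nondeg =>
    exact ⟨fun h x hx => ⟨h x hx x hx, h x hx⟩, fun h x hx => (h x hx).2⟩
  | orthogonal Q nonsing =>
    refine ⟨fun h x hx => ⟨h x hx, fun y hy => ?_⟩, fun h x hx => (h x hx).1⟩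
    simp [form, QuadraticMap.polar, h x hx, h y hy, h _ (W.add_mem hx hy)]

/-- The polar space induced on a subspace that contains no singular vector of its radical. -/
theorem exists_restrict (U : Submodule K V)
    (hU : ∀ x ∈ U, P.quad x = 0 → (∀ y ∈ U, P.form x y = 0) → x = 0) :
    ∃ P' : ClassicalPolarSpace K U, (∀ x : U, P'.quad x = P.quad x) ∧
      (∀ x y : U, P'.form x y = P.form x y) ∧ P'.tr = P.tr := by
  cases P with
  | symplectic B alt nondeg =>
    have h : (B.domRestrict₁₂ U U).SeparatingLeft := fun x hx =>
      Subtype.ext (hU x x.2 rfl fun y hy => hx ⟨y, hy⟩)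
    have halt : (B.domRestrict₁₂ U U).IsAlt := fun x => alt x
    exact ⟨symplectic (B.domRestrict₁₂ U U) halt ⟨h, fun y hy => h y fun x =>
      halt.isRefl _ _ (hy x)⟩, fun _ => rfl, fun _ _ => rfl, rfl⟩
  | hermitian σ hσ B symm nondeg =>
    have h : (B.domRestrict₁₂ U U).SeparatingLeft := fun x hx =>
      Subtype.ext (hU x x.2 (hx x) fun y hy => hx ⟨y, hy⟩)
    have hsymm := symm.domRestrict U
    exact ⟨hermitian σ hσ (B.domRestrict₁₂ U U) hsymm ⟨h, fun y hy => h y fun x =>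
      hsymm.isRefl _ _ (hy x)⟩, fun _ => rfl, fun _ _ => rfl, rfl⟩
  | orthogonal Q nonsing =>
    exact ⟨orthogonal (Q.comp U.subtype) fun x hx h =>
      Subtype.ext (hU x x.2 hx fun y hy => h ⟨y, hy⟩), fun _ => rfl, fun _ _ => rfl, rfl⟩

end Forms

/-! ### Points and collinearity in terms of vectors. -/

section Points

variable {K V : Type*} [Field K] [AddCommGroup V] [Module K V] {P : ClassicalPolarSpace K V}

theorem isSingular_span_singleton {x : V} (hx : P.quad x = 0) : P.IsSingular (K ∙ x) := by
  rw [isSingular_iff]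
  intro y hy
  obtain ⟨a, rfl⟩ := Submodule.mem_span_singleton.1 hy
  refine ⟨quad_smul hx a, fun z hz => ?_⟩
  obtain ⟨b, rfl⟩ := Submodule.mem_span_singleton.1 hz
  simp [form_smul_left, form_self hx]

theorem IsSingular.sup_span {W : Submodule K V} (hW : P.IsSingular W) {x : V} (hx : P.quad x = 0)
    (h : ∀ w ∈ W, P.form x w = 0) : P.IsSingular (W ⊔ K ∙ x) := by
  rw [isSingular_iff] at hW ⊢
  have key : ∀ w ∈ W, ∀ a : K, ∀ w' ∈ W, ∀ b : K, P.form (w + a • x) (w' + b • x) = 0 := by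
    intro w hw a w' hw' b
    simp [form_add_left, form_smul_left, (hW w hw).2 w' hw', h w' hw', form_self hx,
      form_eq_zero_symm (h w hw)]
  intro y hy
  obtain ⟨w, hw, z, hz, rfl⟩ := Submodule.mem_sup.1 hy
  obtain ⟨a, rfl⟩ := Submodule.mem_span_singleton.1 hz
  refine ⟨?_, fun y' hy' => ?_⟩
  · simp [quad_add, (hW w hw).1, quad_smul hx, form_eq_zero_symm (h w hw)]
  · obtain ⟨w', hw', z', hz', rfl⟩ := Submodule.mem_sup.1 hy'
    obtain ⟨b, rfl⟩ := Submodule.mem_span_singleton.1 hz'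
    exact key w hw a w' hw' b

/-- The point spanned by a nonzero singular vector. -/
def mkPoint (P : ClassicalPolarSpace K V) (x : V) (hx : x ≠ 0) (h : P.quad x = 0) : P.Point :=
  ⟨Projectivization.mk K x hx, by
    rw [Projectivization.submodule_mk]; exact isSingular_span_singleton h⟩

/-- A vector spanning a point. -/
noncomputable def Point.vec (p : P.Point) : V := p.1.rep

theorem Point.vec_ne (p : P.Point) : p.vec ≠ 0 := p.1.rep_nonzero

theorem Point.quad_vec (p : P.Point) : P.quad p.vec = 0 := by
  have h := p.2
  rw [Projectivization.submodule_eq, isSingular_iff] at h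
  exact (h _ (Submodule.mem_span_singleton_self _)).1

theorem mkPoint_vec (p : P.Point) : P.mkPoint p.vec p.vec_ne p.quad_vec = p :=
  Subtype.ext p.1.mk_rep

theorem mkPoint_eq_iff {x y : V} {hx : x ≠ 0} {hy : y ≠ 0} {hqx : P.quad x = 0}
    {hqy : P.quad y = 0} : P.mkPoint x hx hqx = P.mkPoint y hy hqy ↔ ∃ a : K, a • y = x := by
  rw [Subtype.ext_iff]
  exact Projectivization.mk_eq_mk_iff' K x y hx hy

theorem exists_smul_eq_vec (x : V) (hx : x ≠ 0) (h : P.quad x = 0) :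
    ∃ a : K, a ≠ 0 ∧ (P.mkPoint x hx h).vec = a • x := by
  obtain ⟨a, ha⟩ := Projectivization.exists_smul_eq_mk_rep K x hx
  exact ⟨a, a.ne_zero, ha.symm⟩

theorem adj_mkPoint_iff {x y : V} {hx : x ≠ 0} {hy : y ≠ 0} {hqx : P.quad x = 0}
    {hqy : P.quad y = 0} : P.collinearityGraph.Adj (P.mkPoint x hx hqx) (P.mkPoint y hy hqy) ↔
      P.mkPoint x hx hqx ≠ P.mkPoint y hy hqy ∧ P.form x y = 0 := by
  refine and_congr_right fun _ => ?_
  simp only [mkPoint, Projectivization.submodule_mk]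
  constructor
  · intro h
    rw [isSingular_iff] at h
    exact (h x (Submodule.mem_sup_left (Submodule.mem_span_singleton_self _))).2 y
      (Submodule.mem_sup_right (Submodule.mem_span_singleton_self _))
  · intro h
    refine (isSingular_span_singleton hqx).sup_span hqy fun w hw => ?_
    obtain ⟨a, rfl⟩ := Submodule.mem_span_singleton.1 hw
    simp [form_eq_zero_symm h]

theorem adj_iff {p r : P.Point} : P.collinearityGraph.Adj p r ↔ p ≠ r ∧ P.form p.vec r.vec = 0 := by
  conv_lhs => rw [← mkPoint_vec p, ← mkPoint_vec r, adj_mkPoint_iff]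
  rw [mkPoint_vec, mkPoint_vec]

theorem adj_mkPoint_left_iff {x : V} {hx : x ≠ 0} {hqx : P.quad x = 0} {r : P.Point} :
    P.collinearityGraph.Adj (P.mkPoint x hx hqx) r ↔
      P.mkPoint x hx hqx ≠ r ∧ P.form x r.vec = 0 := by
  conv_lhs => rw [← mkPoint_vec r, adj_mkPoint_iff]
  rw [mkPoint_vec]

/-- Distinctness comes for free, because a singular vector is orthogonal to its multiples. -/
theorem compl_adj_mkPoint_left_iff {x : V} {hx : x ≠ 0} {hqx : P.quad x = 0} {r : P.Point} :
    P.collinearityGraphᶜ.Adj (P.mkPoint x hx hqx) r ↔ P.form x r.vec ≠ 0 := by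
  rw [SimpleGraph.compl_adj, adj_mkPoint_left_iff]
  constructor
  · tauto
  · refine fun h => ⟨?_, fun h' => h h'.2⟩
    rintro rfl
    obtain ⟨a, -, ha⟩ := exists_smul_eq_vec x hx hqx
    exact h (by rw [ha, map_smul, form_self hqx, smul_zero])

end Points

/-! ### Hyperbolic pairs and counting non-collinear points. -/

section Hyperbolic

variable {K V : Type*} [Field K] [AddCommGroup V] [Module K V] {P : ClassicalPolarSpace K V}

/-- The subspace of all vectors orthogonal to `x` and `y`. -/
def pairPerp (P : ClassicalPolarSpace K V) (x y : V) : Submodule K V :=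
  (P.form x).ker ⊓ (P.form y).ker

theorem mem_pairPerp {x y z : V} : z ∈ P.pairPerp x y ↔ P.form x z = 0 ∧ P.form y z = 0 := Iff.rfl

/-- A hyperbolic pair of singular vectors. -/
structure IsHyperbolicPair (P : ClassicalPolarSpace K V) (x y : V) : Prop where
  quad_left : P.quad x = 0
  quad_right : P.quad y = 0
  form_eq : P.form x y = 1

theorem exists_isHyperbolicPair {x : V} (hx : x ≠ 0) (hq : P.quad x = 0) :
    ∃ y, P.IsHyperbolicPair x y := by
  obtain ⟨z, hz⟩ : ∃ z, P.form x z ≠ 0 := by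
    by_contra! h
    exact hx (eq_zero_of_form hq h)
  let w := (P.form x z)⁻¹ • z
  have hw : P.form x w = 1 := by simp [w, hz]
  have hw' : P.form w x ≠ 0 := fun h => one_ne_zero (hw.symm.trans (form_eq_zero_symm h))
  obtain ⟨a, ha⟩ := P.exists_tr_eq w
  -- Adding a multiple of `x` keeps `form x w` and changes `quad w` by a trace, here chosen to
  -- cancel it.
  refine ⟨w + (a * (P.form w x)⁻¹) • x, hq, ?_, ?_⟩
  · rw [quad_add, quad_smul hq, map_smul, smul_eq_mul, inv_mul_cancel_right₀ hw', ha]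
    ring
  · simp [hw, form_self hq]

theorem isHyperbolicPair_smul {x y : V} (hx : P.quad x = 0) (hy : P.quad y = 0)
    (h : P.form x y ≠ 0) : P.IsHyperbolicPair x ((P.form x y)⁻¹ • y) :=
  ⟨hx, quad_smul hy _, by simp [h]⟩

namespace IsHyperbolicPair

variable {x y : V}

theorem form_symm_ne (h : P.IsHyperbolicPair x y) : P.form y x ≠ 0 := fun h' =>
  one_ne_zero (h.form_eq.symm.trans (form_eq_zero_symm h'))

theorem left_ne (h : P.IsHyperbolicPair x y) : x ≠ 0 := by
  rintro rfl
  exact h.form_symm_ne (map_zero _)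

theorem right_ne (h : P.IsHyperbolicPair x y) : y ≠ 0 := by
  rintro rfl
  exact one_ne_zero (h.form_eq.symm.trans (map_zero _))

/-- The division is needed because `form y x` is `-1` in the symplectic case. -/
theorem sub_mem_pairPerp (h : P.IsHyperbolicPair x y) (v : V) :
    v - P.form x v • y - ((P.form y v) * (P.form y x)⁻¹) • x ∈ P.pairPerp x y := by
  have := h.form_symm_ne
  simp [mem_pairPerp, h.form_eq, form_self h.quad_left, form_self h.quad_right, this]

/-- The decomposition of the space into a hyperbolic line and its perpendicular space. -/
noncomputable def equivProd (h : P.IsHyperbolicPair x y) : K × K × P.pairPerp x y ≃ V where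
  toFun t := t.1 • y + t.2.1 • x + t.2.2
  invFun v := ⟨P.form x v, P.form y v * (P.form y x)⁻¹, _, h.sub_mem_pairPerp v⟩
  left_inv := by
    rintro ⟨a, b, u, hu⟩
    obtain ⟨h1, h2⟩ := mem_pairPerp.1 hu
    have := h.form_symm_ne
    simp [h.form_eq, form_self h.quad_left, form_self h.quad_right, this, h1, h2]
    abel
  right_inv v := by
    simp

theorem eq_zero_of_mem_pairPerp (h : P.IsHyperbolicPair x y) {u : V} (hu : u ∈ P.pairPerp x y) (hq : P.quad u = 0)
    (hf : ∀ w ∈ P.pairPerp x y, P.form u w = 0) : u = 0 := by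
  refine eq_zero_of_form hq fun v => ?_
  obtain ⟨⟨a, b, w⟩, rfl⟩ := h.equivProd.surjective v
  simp [equivProd, form_eq_zero_symm hu.1, form_eq_zero_symm hu.2, hf w w.2]

/-- By cancellation all spaces `pairPerp` have the same size; this does the work of Witt's theorem.
-/
theorem card_eq (h : P.IsHyperbolicPair x y) : Nat.card V = Nat.card K * (Nat.card K * Nat.card (P.pairPerp x y)) := by
  rw [← Nat.card_congr h.equivProd, Nat.card_prod, Nat.card_prod]

theorem quad_add_smul (h : P.IsHyperbolicPair x y) (a : K) (u : P.pairPerp x y) :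
    P.quad (y + a • x + u) = P.quad u + P.tr (a * P.form y x) := by
  have h1 : P.form (y + a • x) u = 0 := by
    simp [form_add_left, form_smul_left, LinearMap.mem_ker.1 u.2.1,
      LinearMap.mem_ker.1 u.2.2]
  rw [quad_add, h1, quad_add, h.quad_right, quad_smul h.quad_left, map_smul, smul_eq_mul, map_zero]
  ring

/-- The singular vectors `z` with `form x z = 1`. -/
noncomputable def equivSingular (h : P.IsHyperbolicPair x y) :
    P.pairPerp x y × P.tr.ker ≃ {z : V // P.quad z = 0 ∧ P.form x z = 1} where
  -- For fixed `u`, singularity prescribes the trace of the coefficient of `x` times `form y x`: the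
  -- solutions are a coset of `tr.ker`, based at the chosen one.
  toFun t := ⟨y + (((P.exists_tr_eq t.1).choose + t.2) * (P.form y x)⁻¹) • x + t.1, by
    refine ⟨?_, ?_⟩
    · rw [h.quad_add_smul, inv_mul_cancel_right₀ h.form_symm_ne, map_add,
        (P.exists_tr_eq t.1).choose_spec, AddMonoidHom.mem_ker.1 t.2.2]
      ring
    · simp [h.form_eq, form_self h.quad_left, LinearMap.mem_ker.1 t.1.2.1]⟩
  invFun z := ⟨⟨_, h.sub_mem_pairPerp z⟩, P.form y z -
      (P.exists_tr_eq (z - P.form x z • y - ((P.form y z) * (P.form y x)⁻¹) • x)).choose, by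
    have hz : P.quad z = 0 := z.2.1
    have key := h.quad_add_smul (P.form y z * (P.form y x)⁻¹) ⟨_, h.sub_mem_pairPerp z⟩
    rw [inv_mul_cancel_right₀ h.form_symm_ne] at key
    have e : y + (P.form y z * (P.form y x)⁻¹) • x +
        (z - P.form x z • y - ((P.form y z) * (P.form y x)⁻¹) • x) = z := by
      rw [z.2.2, one_smul]; abel
    simp only [e, hz] at key
    rw [AddMonoidHom.mem_ker, map_sub, (P.exists_tr_eq _).choose_spec, sub_neg_eq_add, add_comm]
    exact key.symm⟩
  left_inv := by
    rintro ⟨⟨u, hu⟩, b, hb⟩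
    obtain ⟨h1, h2⟩ := mem_pairPerp.1 hu
    have hne := h.form_symm_ne
    have e : (y + (((P.exists_tr_eq u).choose + b) * (P.form y x)⁻¹) • x + u) -
        P.form x (y + (((P.exists_tr_eq u).choose + b) * (P.form y x)⁻¹) • x + u) • y -
        (P.form y (y + (((P.exists_tr_eq u).choose + b) * (P.form y x)⁻¹) • x + u) *
          (P.form y x)⁻¹) • x = u := by
      simp [h.form_eq, form_self h.quad_left, form_self h.quad_right, hne, h1, h2]
      abel
    ext
    · exact e
    · simp only [e]
      simp [form_self h.quad_right, hne, h2]
  right_inv := by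
    rintro ⟨z, hz, hxz⟩
    ext
    simp [hxz]

end IsHyperbolicPair

/-- Points not collinear with the point spanned by `x`. -/
noncomputable def equivComplNeighborSet {x : V} (hx : x ≠ 0) (hq : P.quad x = 0) :
    {z : V // P.quad z = 0 ∧ P.form x z = 1} ≃
      P.collinearityGraphᶜ.neighborSet (P.mkPoint x hx hq) :=
  Equiv.ofBijective
    (fun z => ⟨P.mkPoint z.1 (by rintro h0; simpa [h0] using z.2.2) z.2.1, by
      rw [SimpleGraph.mem_neighborSet, compl_adj_mkPoint_left_iff]
      obtain ⟨a, ha, he⟩ := exists_smul_eq_vec (P := P) z.1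
        (by rintro h0; simpa [h0] using z.2.2) z.2.1
      rw [he, map_smul, z.2.2]
      simpa using ha⟩) (by
    constructor
    · rintro ⟨z, hz, hxz⟩ ⟨w, hw, hxw⟩ he
      obtain ⟨a, ha⟩ := (mkPoint_eq_iff (hqx := hz) (hqy := hw)).1 (congrArg Subtype.val he)
      have : a = 1 := by simpa [hxw, ← ha] using hxz
      subst this
      simpa using ha.symm
    · rintro ⟨r, hr⟩
      rw [SimpleGraph.mem_neighborSet, compl_adj_mkPoint_left_iff] at hr
      refine ⟨⟨(P.form x r.vec)⁻¹ • r.vec, quad_smul r.quad_vec _, by simp [hr]⟩, ?_⟩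
      exact Subtype.ext ((mkPoint_eq_iff (hqx := quad_smul r.quad_vec _)).2 ⟨_, rfl⟩
        |>.trans (mkPoint_vec r)))

theorem IsHyperbolicPair.ncard_compl_neighborSet {x y : V} (h : P.IsHyperbolicPair x y) :
    (P.collinearityGraphᶜ.neighborSet (P.mkPoint x h.left_ne h.quad_left)).ncard =
      Nat.card (P.pairPerp x y) * Nat.card P.tr.ker := by
  rw [← Nat.card_coe_set_eq, ← Nat.card_congr (equivComplNeighborSet h.left_ne h.quad_left),
    ← Nat.card_congr h.equivSingular, Nat.card_prod]

/-! ### The residue and the local graph. -/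

/-- `P'` is the polar space induced by `P` on the perpendicular space of a hyperbolic pair. -/
structure IsResidue (P : ClassicalPolarSpace K V) (x y : V)
    (P' : ClassicalPolarSpace K (P.pairPerp x y)) : Prop extends P.IsHyperbolicPair x y where
  quad_coe : ∀ u, P'.quad u = P.quad u
  form_coe : ∀ u w, P'.form u w = P.form u w
  tr_coe : P'.tr = P.tr

theorem IsHyperbolicPair.exists_isResidue {x y : V} (h : P.IsHyperbolicPair x y) :
    ∃ P', P.IsResidue x y P' := by
  obtain ⟨P', h1, h2, h3⟩ := P.exists_restrict (P.pairPerp x y)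
    fun u hu => h.eq_zero_of_mem_pairPerp hu
  exact ⟨P', h, h1, h2, h3⟩

namespace IsResidue

variable {x y : V} {P' : ClassicalPolarSpace K (P.pairPerp x y)}

theorem coe_vec_ne (p : P'.Point) : (p.vec : V) ≠ 0 := fun h0 => p.vec_ne (Subtype.ext h0)

theorem form_left_vec (p : P'.Point) : P.form x p.vec = 0 := p.vec.2.1

theorem form_right_vec (p : P'.Point) : P.form y p.vec = 0 := p.vec.2.2

theorem isSingular_map_iff (h : P.IsResidue x y P') (W : Submodule K (P.pairPerp x y)) :
    P.IsSingular (W.map (P.pairPerp x y).subtype) ↔ P'.IsSingular W := by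
  rw [isSingular_iff, isSingular_iff]
  constructor
  · intro hW u hu
    obtain ⟨h1, h2⟩ := hW u (Submodule.mem_map_of_mem hu)
    exact ⟨(h.quad_coe u).trans h1, fun w hw => (h.form_coe u w).trans
      (h2 w (Submodule.mem_map_of_mem hw))⟩
  · rintro hW _ ⟨u, hu, rfl⟩
    refine ⟨(h.quad_coe u).symm.trans (hW u hu).1, ?_⟩
    rintro _ ⟨w, hw, rfl⟩
    exact (h.form_coe u w).symm.trans ((hW u hu).2 w hw)

theorem quad_vec (h : P.IsResidue x y P') (p : P'.Point) : P.quad (p.vec : V) = 0 := (h.quad_coe _).symm.trans p.quad_vec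

theorem vec_add_ne (h : P.IsResidue x y P') (a : K) (p : P'.Point) : (p.vec : V) + a • x ≠ 0 := by
  intro h0
  have h1 := congrArg (P.form y) h0
  rw [map_add, form_right_vec, map_smul, map_zero, zero_add, smul_eq_mul, mul_eq_zero,
    or_iff_left h.form_symm_ne] at h1
  subst h1
  exact coe_vec_ne p (by simpa using h0)

theorem quad_vec_add (h : P.IsResidue x y P') (a : K) (p : P'.Point) : P.quad ((p.vec : V) + a • x) = 0 := by
  rw [quad_add, h.quad_vec, quad_smul h.quad_left, map_smul,
    form_eq_zero_symm (form_left_vec p)]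
  simp

/-- Applying `form y` compares the `x`-coefficients; what remains shows `p = r`, and since `vec` is
a fixed representative the proportionality factor is 1. -/
theorem mkPoint_vec_add_eq_iff (h : P.IsResidue x y P') {a b : K} {p r : P'.Point} :
    P.mkPoint _ (h.vec_add_ne a p) (h.quad_vec_add a p) =
      P.mkPoint _ (h.vec_add_ne b r) (h.quad_vec_add b r) ↔ a = b ∧ p = r := by
  constructor
  · intro he
    obtain ⟨c, hc⟩ := mkPoint_eq_iff.1 he
    have h1 := congrArg (P.form y) hc
    simp only [smul_add, map_add, map_smul, form_right_vec, smul_zero, zero_add, smul_smul] at h1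
    rw [smul_eq_mul, smul_eq_mul] at h1
    have h2 : c * b = a := mul_right_cancel₀ h.form_symm_ne h1
    rw [smul_add, smul_smul, h2, add_left_inj] at hc
    have hpr : p = r := by
      rw [← mkPoint_vec p, ← mkPoint_vec r]
      exact mkPoint_eq_iff.2 ⟨c, Subtype.ext hc⟩
    subst hpr
    have hc1 : c = 1 := smul_left_injective K (coe_vec_ne p) (by simpa using hc)
    simpa [hc1] using h2.symm
  · rintro ⟨rfl, rfl⟩
    rfl

/-- Project `r.vec` along `x` into `pairPerp` and rescale by `c` to the chosen representative. The
last clause serves to recognize common neighbours of `⟨x⟩` and `⟨y⟩`. -/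
theorem exists_eq_mkPoint_vec_add (h : P.IsResidue x y P') {r : P.Point}
    (hr : P.collinearityGraph.Adj (P.mkPoint x h.left_ne h.quad_left) r) :
    ∃ (a : K) (p : P'.Point), P.mkPoint _ (h.vec_add_ne a p) (h.quad_vec_add a p) = r ∧
      (P.form y r.vec = 0 → a = 0) := by
  obtain ⟨hne, hf⟩ := adj_mkPoint_left_iff.1 hr
  let b := P.form y r.vec * (P.form y x)⁻¹
  have hmem := h.sub_mem_pairPerp r.vec
  rw [hf, zero_smul, sub_zero] at hmem
  have hu0 : (⟨_, hmem⟩ : P.pairPerp x y) ≠ 0 := by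
    intro h0
    apply hne
    have h0' : b • x = r.vec := (sub_eq_zero.1 (congrArg Subtype.val h0)).symm
    rw [← mkPoint_vec r, eq_comm]
    exact mkPoint_eq_iff.2 ⟨b, h0'⟩
  have huq : P'.quad ⟨_, hmem⟩ = 0 := by
    rw [h.quad_coe]
    change P.quad (r.vec - b • x) = 0
    rw [sub_eq_add_neg, ← neg_smul, quad_add, r.quad_vec, quad_smul h.quad_left, map_smul,
      form_eq_zero_symm hf]
    simp
  obtain ⟨c, hc, he⟩ := exists_smul_eq_vec _ hu0 huq
  refine ⟨c * b, P'.mkPoint _ hu0 huq, ?_, fun h0 => by simp [b, h0]⟩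
  conv_rhs => rw [← mkPoint_vec r]
  refine mkPoint_eq_iff.2 ⟨c, ?_⟩
  rw [he, Submodule.coe_smul, smul_sub, mul_smul c b]
  change c • r.vec = c • r.vec - c • b • x + c • b • x
  rw [sub_add_cancel]

theorem adj_mkPoint_vec_add (h : P.IsResidue x y P') (a : K) (p : P'.Point) :
    P.collinearityGraph.Adj (P.mkPoint x h.left_ne h.quad_left)
      (P.mkPoint _ (h.vec_add_ne a p) (h.quad_vec_add a p)) := by
  rw [adj_mkPoint_iff]
  refine ⟨fun he => ?_, by simp [form_left_vec, form_self h.quad_left]⟩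
  obtain ⟨c, hc⟩ := mkPoint_eq_iff.1 he.symm
  rw [eq_comm, ← sub_eq_zero, add_sub_assoc, ← sub_smul] at hc
  exact h.vec_add_ne _ p hc

/-- The local graph is the clique extension of the collinearity graph of the residue. -/
noncomputable def localIso (h : P.IsResidue x y P') [Finite K] :
    cliqueExtension (Nat.card K) P'.collinearityGraph ≃g
      localGraph P.collinearityGraph (P.mkPoint x h.left_ne h.quad_left) where
  toEquiv := Equiv.ofBijective
    (fun t => ⟨P.mkPoint _ (h.vec_add_ne ((Finite.equivFin K).symm t.1) t.2)
      (h.quad_vec_add ((Finite.equivFin K).symm t.1) t.2), h.adj_mkPoint_vec_add _ _⟩) (by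
    constructor
    · rintro ⟨i, p⟩ ⟨j, r⟩ he
      obtain ⟨h1, h2⟩ := h.mkPoint_vec_add_eq_iff.1 (congrArg Subtype.val he)
      exact Prod.ext ((Finite.equivFin K).symm.injective h1) h2
    · rintro ⟨r, hr⟩
      obtain ⟨a, p, he, -⟩ := h.exists_eq_mkPoint_vec_add hr
      refine ⟨(Finite.equivFin K a, p), Subtype.ext ?_⟩
      simpa using he)
  map_rel_iff' := by
    rintro ⟨i, p⟩ ⟨j, r⟩
    change P.collinearityGraph.Adj
      (P.mkPoint _ (h.vec_add_ne ((Finite.equivFin K).symm i) p) (h.quad_vec_add _ p))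
      (P.mkPoint _ (h.vec_add_ne ((Finite.equivFin K).symm j) r) (h.quad_vec_add _ r)) ↔
      P'.collinearityGraph.Adj p r ∨ (p = r ∧ i ≠ j)
    rw [adj_mkPoint_iff, ne_eq, h.mkPoint_vec_add_eq_iff, adj_iff, h.form_coe]
    -- Multiples of `x` do not affect the form on vectors orthogonal to `x`, so points over the same
    -- `p` form a clique.
    have hf : P.form ((p.vec : V) + (Finite.equivFin K).symm i • x)
        ((r.vec : V) + (Finite.equivFin K).symm j • x) = P.form p.vec r.vec := by
      simp [form_add_left, form_smul_left, form_left_vec, form_self h.quad_left,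
        form_eq_zero_symm (form_left_vec p)]
    rw [hf, (Finite.equivFin K).symm.injective.eq_iff]
    have hpp : p = r → P.form p.vec r.vec = 0 := by
      rintro rfl
      exact form_self (h.quad_vec p)
    tauto

theorem ncard_commonNeighbors (h : P.IsResidue x y P') :
    (P.collinearityGraph.commonNeighbors (P.mkPoint x h.left_ne h.quad_left)
      (P.mkPoint y h.right_ne h.quad_right)).ncard = Nat.card P'.Point := by
  rw [← Nat.card_coe_set_eq]
  have hy (p : P'.Point) : P.collinearityGraph.Adj (P.mkPoint y h.right_ne h.quad_right)
      (P.mkPoint _ (h.vec_add_ne 0 p) (h.quad_vec_add 0 p)) := by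
    rw [adj_mkPoint_iff]
    refine ⟨fun he => ?_, by simp [form_right_vec]⟩
    obtain ⟨c, hc⟩ := mkPoint_eq_iff.1 he
    have := congrArg (P.form x) hc
    simp [form_left_vec, h.form_eq] at this
  refine (Nat.card_congr (Equiv.ofBijective
    (fun p => ⟨P.mkPoint _ (h.vec_add_ne 0 p) (h.quad_vec_add 0 p),
      h.adj_mkPoint_vec_add 0 p, hy p⟩) ?_)).symm
  constructor
  · intro p r he
    exact (h.mkPoint_vec_add_eq_iff.1 (congrArg Subtype.val he)).2
  · rintro ⟨r, hr, hr'⟩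
    obtain ⟨a, p, he, ha⟩ := h.exists_eq_mkPoint_vec_add hr
    have : a = 0 := ha (adj_mkPoint_left_iff.1 hr').2
    subst this
    exact ⟨p, Subtype.ext he⟩

end IsResidue

end Hyperbolic

/-! ### Rank and connectedness. -/

section Rank

variable {K V : Type*} [Field K] [AddCommGroup V] [Module K V]
  {P : ClassicalPolarSpace K V}

theorem HasRank.exists_vector {n : ℕ} (hP : P.HasRank n) (hn : 1 ≤ n) :
    ∃ x, x ≠ 0 ∧ P.quad x = 0 := by
  obtain ⟨W, hW, hWn⟩ := hP.1
  have : W ≠ ⊥ := by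
    rintro rfl
    rw [finrank_bot] at hWn
    omega
  obtain ⟨x, hx, hx0⟩ := W.exists_mem_ne_zero_of_ne_bot this
  exact ⟨x, hx0, ((P.isSingular_iff W).1 hW x hx).1⟩

theorem Point.exists_isHyperbolicPair (p : P.Point) :
    ∃ (x y : V) (h : P.IsHyperbolicPair x y), p = P.mkPoint x h.left_ne h.quad_left := by
  obtain ⟨y, h⟩ := ClassicalPolarSpace.exists_isHyperbolicPair p.vec_ne p.quad_vec
  exact ⟨_, _, h, (mkPoint_vec p).symm⟩

theorem exists_isHyperbolicPair_of_compl_adj {p r : P.Point} (hpr : P.collinearityGraphᶜ.Adj p r) :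
    ∃ (x y : V) (h : P.IsHyperbolicPair x y), p = P.mkPoint x h.left_ne h.quad_left ∧
      r = P.mkPoint y h.right_ne h.quad_right := by
  rw [← mkPoint_vec p, compl_adj_mkPoint_left_iff] at hpr
  have h := isHyperbolicPair_smul p.quad_vec r.quad_vec hpr
  refine ⟨_, _, h, (mkPoint_vec p).symm, (mkPoint_vec r).symm.trans (mkPoint_eq_iff.2 ?_)⟩
  exact ⟨P.form p.vec r.vec, by rw [smul_smul, mul_inv_cancel₀ hpr, one_smul]⟩

/-- Two collinear points always have a common non-collinear point. -/
theorem HasRank.collinearityGraph_compl_connected {n : ℕ} (hP : P.HasRank n) (hn : 1 ≤ n) :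
    P.collinearityGraphᶜ.Connected := by
  obtain ⟨x, hx, hq⟩ := hP.exists_vector hn
  have : Nonempty P.Point := ⟨P.mkPoint x hx hq⟩
  have compl_adj {x y : V} (hx : x ≠ 0) (hqx : P.quad x = 0) (hy : y ≠ 0) (hqy : P.quad y = 0)
      (hxy : P.form x y ≠ 0) :
      P.collinearityGraphᶜ.Adj (P.mkPoint x hx hqx) (P.mkPoint y hy hqy) := by
    rw [compl_adj_mkPoint_left_iff]
    obtain ⟨a, ha, he⟩ := exists_smul_eq_vec y hy hqy
    rw [he, map_smul]
    exact mul_ne_zero ha hxy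
  have key {p r : P.Point} (hrp : P.form p.vec r.vec = 0) : ∃ z, z ≠ 0 ∧ P.quad z = 0 ∧
      P.form p.vec z ≠ 0 ∧ P.form r.vec z ≠ 0 := by
    obtain ⟨y, h⟩ := exists_isHyperbolicPair p.vec_ne p.quad_vec
    by_cases hry : P.form r.vec y = 0
    -- When `y` is orthogonal to `r`, the vector of `r` lies in the residue; its hyperbolic partner
    -- `w` there repairs `y` to `y + w`.
    · obtain ⟨P', hP'⟩ := h.exists_isResidue
      let u : P.pairPerp p.vec y := ⟨r.vec, hrp, form_eq_zero_symm hry⟩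
      have hu : u ≠ 0 := fun h0 => r.vec_ne (congrArg Subtype.val h0)
      have hqu : P'.quad u = 0 := (hP'.quad_coe u).trans r.quad_vec
      obtain ⟨w, huw⟩ := exists_isHyperbolicPair hu hqu
      have hqw : P.quad w = 0 := (hP'.quad_coe w).symm.trans huw.quad_right
      have huw1 : P.form r.vec w = 1 := (hP'.form_coe u w).symm.trans huw.form_eq
      have hp1 : P.form p.vec (y + w) ≠ 0 := by
        rw [map_add, h.form_eq, show P.form p.vec w = 0 from w.2.1, add_zero]
        exact one_ne_zero
      refine ⟨y + w, fun h0 => hp1 (by rw [h0, map_zero]), ?_, hp1, ?_⟩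
      · rw [quad_add, h.quad_right, hqw, show P.form y w = 0 from w.2.2]
        simp
      · rw [map_add, hry, huw1, zero_add]
        exact one_ne_zero
    · refine ⟨y, h.right_ne, h.quad_right, ?_, hry⟩
      rw [h.form_eq]
      exact one_ne_zero
  refine ⟨fun p r => ?_⟩
  rw [← mkPoint_vec p, ← mkPoint_vec r]
  by_cases hpr : P.form p.vec r.vec = 0
  · obtain ⟨z, hz, hq, hp, hr⟩ := key hpr
    exact (compl_adj _ _ hz hq hp).reachable.trans (compl_adj _ _ hz hq hr).symm.reachable
  · exact (compl_adj _ _ _ _ hpr).reachable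

variable [FiniteDimensional K V]

theorem finrank_le_finrank_inf_ker_add_one (W : Submodule K V) (f : V →ₗ[K] K) :
    Module.finrank K W ≤ Module.finrank K (W ⊓ f.ker : Submodule K V) + 1 := by
  have h1 := (f.domRestrict W).finrank_range_add_finrank_ker
  have h2 : Module.finrank K (f.domRestrict W).range ≤ 1 :=
    (Submodule.finrank_le _).trans (Module.finrank_self K).le
  have h3 : (f.domRestrict W).ker.map W.subtype = W ⊓ f.ker := by
    ext v
    simp [and_comm]
  rw [← h3, Submodule.finrank_map_subtype_eq]
  omega

theorem finrank_sup_span {W : Submodule K V} {x : V} (hx : x ∉ W) :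
    Module.finrank K (W ⊔ K ∙ x : Submodule K V) = Module.finrank K W + 1 := by
  have hx0 : x ≠ 0 := by
    rintro rfl
    exact hx W.zero_mem
  have h1 := Submodule.finrank_sup_add_finrank_inf_eq W (K ∙ x)
  have h2 : W ⊓ K ∙ x = ⊥ :=
    disjoint_iff.1 ((Submodule.disjoint_span_singleton' hx0).2 hx)
  rw [h2, finrank_bot, finrank_span_singleton hx0] at h1
  exact h1

/-- Adjoining `x` to a singular subspace of the residue gives the upper bound. Conversely, a maximal
`W` can be exchanged for one inside the perpendicular space of `x` without loss of dimension, and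
intersecting with that of `y` costs at most one. -/
theorem IsResidue.hasRank {x y : V} {P' : ClassicalPolarSpace K (P.pairPerp x y)}
    (h : P.IsResidue x y P') {n : ℕ} (hP : P.HasRank n) : P'.HasRank (n - 1) := by
  obtain ⟨⟨W, hW, hWn⟩, hmax⟩ := hP
  have hub : ∀ W' : Submodule K (P.pairPerp x y), P'.IsSingular W' →
      Module.finrank K W' + 1 ≤ n := by
    intro W' hW'
    rw [← h.isSingular_map_iff] at hW'
    have hx : x ∉ W'.map (P.pairPerp x y).subtype := by
      rintro ⟨u, -, hu⟩
      exact h.form_symm_ne (by rw [← hu]; exact u.2.2)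
    refine hmax ⟨_, hW'.sup_span h.quad_left ?_, ?_⟩
    · rintro _ ⟨u, -, rfl⟩
      exact u.2.1
    · rw [finrank_sup_span hx, Submodule.finrank_map_subtype_eq]
  obtain ⟨X, hX, hXx, hXn⟩ : ∃ X : Submodule K V, P.IsSingular X ∧ X ≤ (P.form x).ker ∧
      n ≤ Module.finrank K X := by
    by_cases hx : x ∈ W
    · exact ⟨W, hW, fun w hw => ((P.isSingular_iff W).1 hW x hx).2 w hw, hWn.ge⟩
    · have hW' : P.IsSingular (W ⊓ (P.form x).ker) := by
        rw [isSingular_iff] at hW ⊢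
        exact fun w hw => ⟨(hW w hw.1).1, fun z hz => (hW w hw.1).2 z hz.1⟩
      refine ⟨_, hW'.sup_span h.quad_left fun w hw => hw.2, sup_le inf_le_right ?_, ?_⟩
      · rw [Submodule.span_singleton_le_iff_mem]
        exact form_self h.quad_left
      · rw [finrank_sup_span fun hx' => hx (Submodule.mem_inf.1 hx').1, ← hWn]
        exact finrank_le_finrank_inf_ker_add_one W _
  let Y := (X ⊓ (P.form y).ker).comap (P.pairPerp x y).subtype
  have hYmap : Y.map (P.pairPerp x y).subtype = X ⊓ (P.form y).ker :=
    Submodule.map_comap_eq_of_le (by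
      rw [Submodule.range_subtype]
      exact fun v hv => ⟨hXx hv.1, hv.2⟩)
  have hY : P'.IsSingular Y := by
    rw [← h.isSingular_map_iff, hYmap]
    rw [isSingular_iff] at hX ⊢
    exact fun w hw => ⟨(hX w hw.1).1, fun z hz => (hX w hw.1).2 z hz.1⟩
  have hYn : n ≤ Module.finrank K Y + 1 := by
    rw [← Submodule.finrank_map_subtype_eq, hYmap]
    exact hXn.trans (finrank_le_finrank_inf_ker_add_one X _)
  -- `hub` also forces `1 ≤ n`, so the truncated subtraction is harmless.
  refine ⟨⟨Y, hY, ?_⟩, ?_⟩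
  · have := hub Y hY
    omega
  · rintro _ ⟨W', hW', rfl⟩
    have := hub W' hW'
    omega

/-! ### Strong regularity of the collinearity graph. -/

variable (P) in
/-- The collinearity graph of a finite classical polar space is strongly regular. -/
theorem isStronglyRegular_collinearityGraph [Finite K] :
    IsStronglyRegular P.collinearityGraph := by
  have hV : Finite V := Module.finite_of_finite K
  have hK : 0 < Nat.card K := Nat.card_pos
  have hperp {x y x' y' : V} (h : P.IsHyperbolicPair x y) (h' : P.IsHyperbolicPair x' y') :
      Nat.card (P.pairPerp x y) = Nat.card (P.pairPerp x' y') := by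
    have := h.card_eq.symm.trans h'.card_eq
    exact Nat.eq_of_mul_eq_mul_left hK (Nat.eq_of_mul_eq_mul_left hK this)
  have hreg : ∀ p r, (P.collinearityGraph.neighborSet p).ncard =
      (P.collinearityGraph.neighborSet r).ncard := by
    intro p r
    have hp := ncard_neighborSet_add_ncard_compl P.collinearityGraph p
    have hr := ncard_neighborSet_add_ncard_compl P.collinearityGraph r
    obtain ⟨x, y, h, rfl⟩ := p.exists_isHyperbolicPair
    obtain ⟨x', y', h', rfl⟩ := r.exists_isHyperbolicPair
    rw [h.ncard_compl_neighborSet] at hp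
    rw [h'.ncard_compl_neighborSet, ← hperp h h'] at hr
    omega
  have hcount {x y : V} {P' : ClassicalPolarSpace K (P.pairPerp x y)} (h : P.IsResidue x y P') :
      (P.collinearityGraph.neighborSet (P.mkPoint x h.left_ne h.quad_left)).ncard =
        Nat.card K * Nat.card P'.Point := by
    rw [← Nat.card_coe_set_eq, ← Nat.card_congr h.localIso.toEquiv, Nat.card_prod, Nat.card_fin]
  -- Common neighbours of `p` and `r` are the neighbours of `r` in the local graph at `p`. Its
  -- non-neighbours there are `q` copies of those in the residue, counted by a second hyperbolic
  -- pair.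
  have hadj {p r : P.Point} (hpr : P.collinearityGraph.Adj p r) :
      ∃ (x y : V) (_ : P.IsHyperbolicPair x y) (u w : P.pairPerp x y)
        (P' : ClassicalPolarSpace K (P.pairPerp x y)) (_ : P.IsResidue x y P'),
        P'.IsHyperbolicPair u w ∧ (P.collinearityGraph.commonNeighbors p r).ncard +
          Nat.card K * (Nat.card (P'.pairPerp u w) * Nat.card P.tr.ker) + 1 =
          (P.collinearityGraph.neighborSet p).ncard := by
    obtain ⟨x, y, h, rfl⟩ := p.exists_isHyperbolicPair
    obtain ⟨P', hP'⟩ := h.exists_isResidue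
    obtain ⟨t, ht⟩ := hP'.localIso.surjective ⟨r, hpr⟩
    obtain ⟨u, w, huw, hs⟩ := t.2.exists_isHyperbolicPair
    refine ⟨x, y, h, u, w, P', hP', huw, ?_⟩
    have h1 := ncard_neighborSet_add_ncard_compl
      (cliqueExtension (Nat.card K) P'.collinearityGraph) t
    rw [ncard_compl_neighborSet_cliqueExtension, hs, huw.ncard_compl_neighborSet, hP'.tr_coe,
      ← ncard_neighborSet_iso hP'.localIso, ht, ncard_neighborSet_localGraph,
      Nat.card_congr hP'.localIso.toEquiv, Nat.card_coe_set_eq] at h1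
    exact h1
  refine isStronglyRegular_iff.2 ⟨hreg, fun p r p' r' hpr hpr' => ?_,
    fun p r p' r' hpr hpr' => ?_⟩
  · obtain ⟨x, y, h, u, w, P₁, hP₁, huw, e⟩ := hadj hpr
    obtain ⟨x', y', h', u', w', P₂, hP₂, huw', e'⟩ := hadj hpr'
    have hc : Nat.card (P₁.pairPerp u w) = Nat.card (P₂.pairPerp u' w') := by
      have := (huw.card_eq.symm.trans (hperp h h')).trans huw'.card_eq
      exact Nat.eq_of_mul_eq_mul_left hK (Nat.eq_of_mul_eq_mul_left hK this)
    rw [hc, hreg p p'] at e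
    omega
  · obtain ⟨x, y, h, rfl, rfl⟩ := exists_isHyperbolicPair_of_compl_adj hpr
    obtain ⟨x', y', h', rfl, rfl⟩ := exists_isHyperbolicPair_of_compl_adj hpr'
    obtain ⟨P₁, hP₁⟩ := h.exists_isResidue
    obtain ⟨P₂, hP₂⟩ := h'.exists_isResidue
    rw [hP₁.ncard_commonNeighbors, hP₂.ncard_commonNeighbors]
    -- Both valencies are `q` times the number of residue points, so regularity forces equal
    -- numbers.
    refine Nat.eq_of_mul_eq_mul_left hK ?_
    rw [← hcount hP₁, ← hcount hP₂]
    exact hreg _ _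

/-- Any residue point is a common neighbour of two non-collinear points, and it exists because the
residue has rank at least one. -/
theorem HasRank.collinearityGraph_connected {n : ℕ} (hP : P.HasRank n) (hn : 2 ≤ n) :
    P.collinearityGraph.Connected := by
  obtain ⟨x, hx, hq⟩ := hP.exists_vector (by omega)
  have : Nonempty P.Point := ⟨P.mkPoint x hx hq⟩
  refine ⟨fun p r => ?_⟩
  by_cases hpr : p = r
  · exact hpr ▸ SimpleGraph.Reachable.refl _
  by_cases hadj : P.collinearityGraph.Adj p r
  · exact hadj.reachable
  obtain ⟨x, y, h, rfl, rfl⟩ := exists_isHyperbolicPair_of_compl_adj ⟨hpr, hadj⟩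
  obtain ⟨P', hP'⟩ := h.exists_isResidue
  obtain ⟨u, hu, hqu⟩ := (hP'.hasRank hP).exists_vector (by omega)
  rw [hP'.quad_coe] at hqu
  have hu0 : (u : V) ≠ 0 := fun h0 => hu (Subtype.ext h0)
  have h1 : P.collinearityGraph.Adj (P.mkPoint x h.left_ne h.quad_left) (P.mkPoint u hu0 hqu) := by
    rw [adj_mkPoint_iff]
    refine ⟨fun he => ?_, u.2.1⟩
    obtain ⟨a, ha⟩ := mkPoint_eq_iff.1 he
    exact h.form_symm_ne (by rw [← ha, map_smul, show P.form y u = 0 from u.2.2, smul_zero])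
  have h2 : P.collinearityGraph.Adj (P.mkPoint y h.right_ne h.quad_right)
      (P.mkPoint u hu0 hqu) := by
    rw [adj_mkPoint_iff]
    refine ⟨fun he => ?_, u.2.2⟩
    obtain ⟨a, ha⟩ := mkPoint_eq_iff.1 he
    have h3 := h.form_eq
    rw [← ha, map_smul, show P.form x u = 0 from u.2.1, smul_zero] at h3
    exact zero_ne_one h3
  exact h1.reachable.trans h2.symm.reachable

/-- The collinearity graph of a finite classical polar space of rank at least two is a primitive
strongly regular graph. -/
theorem HasRank.isPrimitiveSRG [Finite K] {n : ℕ} (hP : P.HasRank n) (hn : 2 ≤ n) :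
    IsPrimitiveSRG P.collinearityGraph := by
  refine ⟨P.isStronglyRegular_collinearityGraph, ?_, hP.collinearityGraph_connected hn,
    hP.collinearityGraph_compl_connected (by omega)⟩
  obtain ⟨x, hx, hq⟩ := hP.exists_vector (by omega)
  obtain ⟨y, h⟩ := exists_isHyperbolicPair hx hq
  refine ⟨P.mkPoint x hx hq, P.mkPoint y h.right_ne h.quad_right, fun he => ?_⟩
  obtain ⟨a, ha⟩ := mkPoint_eq_iff.1 he.symm
  have h1 := h.form_eq
  rw [← ha, map_smul, form_self hq, smul_zero] at h1
  exact zero_ne_one h1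

end Rank

end ClassicalPolarSpace

theorem mainTheorem10 {K : Type u} {V : Type v} [Field K] [Finite K] [AddCommGroup V]
    [Module K V] [FiniteDimensional K V] (P : ClassicalPolarSpace K V) (n : ℕ) (hn : 3 ≤ n)
    (hP : P.HasRank n) :
    -- the collinearity graph is primitive strongly regular, and not triply transitive
    IsPrimitiveSRG P.collinearityGraph ∧
    ¬ IsTriplyTransitive P.collinearityGraph ∧
    -- the local graph at every point is the `q`-clique extension of a primitive polar graph
    (∀ p : P.Point,
      ∃ (V' : Type v) (_ : AddCommGroup V') (_ : Module K V') (_ : FiniteDimensional K V')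
        (P' : ClassicalPolarSpace K V'),
        P'.HasRank (n - 1) ∧ IsPrimitiveSRG P'.collinearityGraph ∧
        Nonempty (localGraph P.collinearityGraph p ≃g
          cliqueExtension (Nat.card K) P'.collinearityGraph)) ∧
    -- no local graph is strongly regular
    (∀ p : P.Point, ¬ IsStronglyRegular (localGraph P.collinearityGraph p)) ∧
    -- clique extensions of primitive strongly regular graphs are never strongly regular
    (∀ (W : Type w) [Finite W] (G : SimpleGraph W), IsPrimitiveSRG G →
      ∀ m : ℕ, 2 ≤ m → ¬ IsStronglyRegular (cliqueExtension m G)) := by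
  have hlocal (p : P.Point) :
      ∃ (V' : Type v) (_ : AddCommGroup V') (_ : Module K V') (_ : FiniteDimensional K V')
        (P' : ClassicalPolarSpace K V'),
        P'.HasRank (n - 1) ∧ IsPrimitiveSRG P'.collinearityGraph ∧
        Nonempty (localGraph P.collinearityGraph p ≃g
          cliqueExtension (Nat.card K) P'.collinearityGraph) := by
    obtain ⟨x, y, h, rfl⟩ := p.exists_isHyperbolicPair
    obtain ⟨P', hP'⟩ := h.exists_isResidue
    -- Here `3 ≤ n` enters: the residue needs rank at least two for a connected graph.
    exact ⟨P.pairPerp x y, inferInstance, inferInstance, inferInstance, P', hP'.hasRank hP,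
      (hP'.hasRank hP).isPrimitiveSRG (by omega), ⟨hP'.localIso.symm⟩⟩
  have hnot (p : P.Point) : ¬ IsStronglyRegular (localGraph P.collinearityGraph p) := by
    obtain ⟨V', _, _, _, P', -, hprim, ⟨e⟩⟩ := hlocal p
    exact fun h => not_isStronglyRegular_cliqueExtension hprim Finite.one_lt_card (h.of_iso e)
  refine ⟨hP.isPrimitiveSRG (by omega), fun h => ?_, hlocal, hnot,
    fun W _ G hG m hm => not_isStronglyRegular_cliqueExtension hG hm⟩
  obtain ⟨x, hx, hq⟩ := hP.exists_vector (by omega)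
  let _ : Fintype P.Point := Fintype.ofFinite P.Point
  -- Only `T_0 = T` at a single point is contradicted.
  exact hnot (P.mkPoint x hx hq) (isStronglyRegular_localGraph (h.2 _).1)
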